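/- Let $n\ge 1$, let $k$ be a field, and let $(\mathcal C,\Sigma^n,\Theta)$ be a $k$-linear $(n+2)$-angulated category in the sense of Geiss–Keller–Oppermann, that is: $\mathcal C$ is an additive $k$-linear category, $\Sigma^n$ is an automorphism (or, more generally, an autoequivalence) of $\mathcal C$, and $\Theta$ is a class of sequences $A_0\to A_1\to\cdots\to A_{n+1}\to\Sigma^nA_0$ (the $(n+2)$-angles) satisfying the axioms (N1)–(N4). Let $X\in\mathcal C$ be an Oppermann–Thomas cluster tilting object, that is: (1) $\operatorname{Hom}_{\mathcal C}(X,\Sigma^nX)=0$, and (2) for each object $C\in\mathcal C$ there is an $(n+2)$-angle $$X_0\to X_1\to\cdots\to X_n\to C\to\Sigma^nX_0$$ with $X_0,\dots,X_n\in\operatorname{add}X$, where $\operatorname{add} X$ consists of the direct summands of finite direct sums of copies of $X$. Assume that the endomorphism algebra $\Gamma=\operatorname{End}_{\mathcal C}(X)$ is finite dimensional over $k$. Then each right $\Gamma$-module (in particular each finite dimensional one) has either infinite projective dimension or projective dimension at most $n$. -/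

import Mathlib

open CategoryTheory CategoryTheory.Limits

universe w v u

namespace HigherAngulated

variable {C : Type u} [Category.{v} C]

/-- An `(n+2)`-`S`-sequence
`A₀ ⟶ A₁ ⟶ ⋯ ⟶ A_{n+1} ⟶ S A₀`: the maps `map i : A_i ⟶ A_{i+1}` for `0 ≤ i ≤ n`, and the
last map `A_{n+1} ⟶ S A₀`. Here `S` plays the role of the `n`-suspension `Σⁿ`. -/
structure SuspSeq (S : C ⥤ C) (n : ℕ) where
  obj : Fin (n + 2) → C
  map : ∀ i : Fin (n + 1), obj i.castSucc ⟶ obj i.succ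
  last : obj (Fin.last (n + 1)) ⟶ S.obj (obj 0)

namespace SuspSeq

variable {S : C ⥤ C} {n : ℕ}

/-- The first map `f₀ : A₀ ⟶ A₁` of a sequence. -/
def first (A : SuspSeq S n) : A.obj 0 ⟶ A.obj (Fin.succ 0) := A.map 0

/-- A morphism `(φ₀, …, φ_{n+1})` of sequences; the last square involves `S φ₀`. -/
structure Hom (A B : SuspSeq S n) where
  app : ∀ i : Fin (n + 2), A.obj i ⟶ B.obj i
  comm : ∀ i : Fin (n + 1), A.map i ≫ app i.succ = app i.castSucc ≫ B.map i
  comm_last : A.last ≫ S.map (app 0) = app (Fin.last (n + 1)) ≫ B.last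

/-- An isomorphism of sequences is a morphism all of whose components are isomorphisms. -/
def Hom.IsIsomorphism {A B : SuspSeq S n} (φ : Hom A B) : Prop :=
  ∀ i, IsIso (φ.app i)

/-- The objects `A₀, A₁, …, A_{n+1}, S A₀` of a sequence, the final `S A₀` included. -/
def ext (A : SuspSeq S n) : Fin (n + 3) → C :=
  Fin.snoc (α := fun _ => C) A.obj (S.obj (A.obj 0))

theorem ext_castSucc (A : SuspSeq S n) (i : Fin (n + 2)) : A.ext i.castSucc = A.obj i :=
  Fin.snoc_castSucc (α := fun _ => C) _ _ i

theorem ext_last (A : SuspSeq S n) : A.ext (Fin.last (n + 2)) = S.obj (A.obj 0) :=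
  Fin.snoc_last (α := fun _ => C) _ _

/-- All the `n + 2` maps `f₀, …, f_n, f_{n+1}` of a sequence (the occurrences of `eqToHom` are
the identifications of the two names of one object). -/
def extMap (A : SuspSeq S n) (i : Fin (n + 2)) : A.ext i.castSucc ⟶ A.ext i.succ :=
  Fin.lastCases (motive := fun i => A.ext i.castSucc ⟶ A.ext i.succ)
    (eqToHom (A.ext_castSucc _) ≫ A.last ≫ eqToHom A.ext_last.symm)
    (fun j => eqToHom (A.ext_castSucc _) ≫ A.map j ≫ eqToHom (A.ext_castSucc j.succ).symm) i

/-- All the components `φ₀, …, φ_{n+1}, S φ₀` of a morphism. -/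
def Hom.extApp {A B : SuspSeq S n} (φ : Hom A B) (i : Fin (n + 3)) : A.ext i ⟶ B.ext i :=
  Fin.lastCases (motive := fun i => A.ext i ⟶ B.ext i)
    (eqToHom A.ext_last ≫ S.map (φ.app 0) ≫ eqToHom B.ext_last.symm)
    (fun j => eqToHom (A.ext_castSucc j) ≫ φ.app j ≫ eqToHom (B.ext_castSucc j).symm) i

section Preadditive

variable [Preadditive C]

/-- The left rotation
`A₁ ⟶ A₂ ⟶ ⋯ ⟶ A_{n+1} ⟶ S A₀ ⟶ S A₁`, with last map `(-1)ⁿ S f₀`. -/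
def rotate (A : SuspSeq S n) : SuspSeq S n where
  obj i := A.ext i.succ
  map i := A.extMap i.succ
  last := eqToHom A.ext_last ≫ ((-1 : ℤ) ^ n • S.map A.first) ≫
    eqToHom (congrArg S.obj (A.ext_castSucc (Fin.succ 0)).symm)

section Zero

variable [HasZeroObject C]

open scoped ZeroObject

/-- The trivial sequence `A ⟶ A ⟶ 0 ⟶ ⋯ ⟶ 0 ⟶ S A`, whose first map is the identity. -/
noncomputable def trivial (S : C ⥤ C) (n : ℕ) (A : C) : SuspSeq S n where
  obj := Fin.cons (α := fun _ => C) A (Fin.cons (α := fun _ => C) A (fun _ => (0 : C)))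
  map := Fin.cases (𝟙 A) (fun _ => 0)
  last := 0

end Zero

variable [HasBinaryBiproducts C]

/-- The direct sum of two sequences (the last map is written through the canonical map
`S A₀ ⊞ S B₀ ⟶ S (A₀ ⊞ B₀)`). -/
noncomputable def directSum (A B : SuspSeq S n) : SuspSeq S n where
  obj i := A.obj i ⊞ B.obj i
  map i := biprod.map (A.map i) (B.map i)
  last := biprod.desc (A.last ≫ S.map biprod.inl) (B.last ≫ S.map biprod.inr)

/-- The mapping cone
`A₁ ⊞ B₀ ⟶ A₂ ⊞ B₁ ⟶ ⋯ ⟶ S A₀ ⊞ B_{n+1} ⟶ S (A₁ ⊞ B₀)` of a morphism `φ`.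
The map leaving `A_{i+1} ⊞ B_i` has components `-f_{i+1}` and `φ_{i+1}` on `A_{i+1}`, and `g_i`
on `B_i`; the last one has components `-S f₀` and `S φ₀` on `S A₀`, and `g_{n+1}` on `B_{n+1}`. -/
noncomputable def cone {A B : SuspSeq S n} (φ : Hom A B) : SuspSeq S n where
  obj i := A.ext i.succ ⊞ B.ext i.castSucc
  map i := biprod.desc
    (biprod.lift (-A.extMap i.succ) (φ.extApp i.castSucc.succ))
    (biprod.lift 0 (B.extMap i.castSucc))
  last :=
    let inA : A.obj (Fin.succ 0) ⟶ A.ext (Fin.succ 0) ⊞ B.ext 0 :=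
      eqToHom (A.ext_castSucc (Fin.succ 0)).symm ≫ biprod.inl
    let inB : B.obj 0 ⟶ A.ext (Fin.succ 0) ⊞ B.ext 0 :=
      eqToHom (B.ext_castSucc 0).symm ≫ biprod.inr
    biprod.desc
      (eqToHom A.ext_last ≫ (-(S.map A.first ≫ S.map inA) + S.map (φ.app 0) ≫ S.map inB))
      (eqToHom (B.ext_castSucc _) ≫ B.last ≫ S.map inB)

end Preadditive

end SuspSeq

section Additive

variable [Preadditive C] [HasZeroObject C] [HasFiniteBiproducts C]

attribute [local instance] hasBinaryBiproducts_of_finite_biproducts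

/-- `(C, S, Θ)` is an `(n+2)`-angulated category: `C` is additive, `S` is an autoequivalence of `C`
(for instance an automorphism), and the class `Θ` of `(n+2)`-angles satisfies the axioms
(N1)–(N4) of Geiss, Keller and Oppermann. -/
structure IsAngulated (S : C ⥤ C) (n : ℕ) (Θ : Set (SuspSeq S n)) : Prop where
  /-- The suspension is an autoequivalence. -/
  isEquivalence : S.IsEquivalence
  /-- (N1)(a): closure under isomorphisms. -/
  iso_mem : ∀ (A B : SuspSeq S n) (φ : SuspSeq.Hom A B), φ.IsIsomorphism → A ∈ Θ → B ∈ Θ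
  /-- (N1)(a): closure under direct sums and direct summands. -/
  directSum_mem_iff : ∀ A B : SuspSeq S n, A.directSum B ∈ Θ ↔ A ∈ Θ ∧ B ∈ Θ
  /-- (N1)(b): trivial sequences. -/
  trivial_mem : ∀ A : C, SuspSeq.trivial S n A ∈ Θ
  /-- (N1)(c): each morphism is the first map of an `(n+2)`-angle. -/
  extend : ∀ {A₀ A₁ : C} (f : A₀ ⟶ A₁), ∃ A ∈ Θ,
    ∃ (e₀ : A₀ ≅ A.obj 0) (e₁ : A₁ ≅ A.obj (Fin.succ 0)),
      f ≫ e₁.hom = e₀.hom ≫ A.first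
  /-- (N2): rotation. -/
  rotate_mem_iff : ∀ A : SuspSeq S n, A.rotate ∈ Θ ↔ A ∈ Θ
  /-- (N3): completion of a commutative square to a morphism of `(n+2)`-angles. -/
  complete : ∀ A ∈ Θ, ∀ B ∈ Θ, ∀ (φ₀ : A.obj 0 ⟶ B.obj 0)
    (φ₁ : A.obj (Fin.succ 0) ⟶ B.obj (Fin.succ 0)), A.first ≫ φ₁ = φ₀ ≫ B.first →
      ∃ φ : SuspSeq.Hom A B, φ.app 0 = φ₀ ∧ φ.app (Fin.succ 0) = φ₁
  /-- (N4): the completion can be chosen such that the mapping cone is an `(n+2)`-angle. -/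
  complete_cone : ∀ A ∈ Θ, ∀ B ∈ Θ,
    ∀ (φ₀ : A.obj 0 ⟶ B.obj 0)
    (φ₁ : A.obj (Fin.succ 0) ⟶ B.obj (Fin.succ 0)), A.first ≫ φ₁ = φ₀ ≫ B.first →
      ∃ φ : SuspSeq.Hom A B, φ.app 0 = φ₀ ∧ φ.app (Fin.succ 0) = φ₁ ∧
        SuspSeq.cone φ ∈ Θ

/-- `Y` lies in `add X`: it is a direct summand of a direct sum of finitely many copies
of `X`. -/
def InAdd (X Y : C) : Prop :=
  ∃ (m : ℕ) (Z : C), Nonempty (Y ⊞ Z ≅ ⨁ fun _ : Fin m => X)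

/-- `X` is an Oppermann–Thomas cluster tilting object: `Hom(X, S X) = 0`, and each object `Y` is
the term `A_{n+1}` of an `(n+2)`-angle `A₀ ⟶ ⋯ ⟶ A_n ⟶ Y ⟶ S A₀` with
`A₀, …, A_n` in `add X`. -/
structure IsClusterTilting {S : C ⥤ C} {n : ℕ} (Θ : Set (SuspSeq S n)) (X : C) : Prop where
  rigid : ∀ f : X ⟶ S.obj X, f = 0
  exists_angle : ∀ Y : C, ∃ A ∈ Θ, (∀ i : Fin (n + 1), InAdd X (A.obj i.castSucc)) ∧
    Nonempty (A.obj (Fin.last (n + 1)) ≅ Y)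

end Additive

end HigherAngulated

/-! The heart is that Γ, and each direct sum of copies of it, has injective dimension at most n as a
right module. If M had finite projective dimension d > n, then Ext^d(M, -) would be right exact and
zero on free modules, hence zero, a contradiction.

For the injective dimension, take an angle A_0 → ⋯ → A_n → S⁻¹X with all A_i in add X. Neighbouring
maps of angles are weak kernels and weak cokernels of each other, so Hom(X, -) is exact along S A_n
→ X → S²A_0 → ⋯ → S²A_n → S X. Rigidity kills both ends, leaving 0 → Γ → Hom(X, S²A_0) → ⋯ → Hom(X,
S²A_n) → 0. The terms are injective by Baer's criterion, which `IsClusterTilting.exists_factor`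
reduces to Hom(add X, S(add X)) = 0. Since Γ is Noetherian, direct sums of copies of them stay
injective; these are needed because M may be infinitely generated. -/

/-! ### Injective dimension of free modules and finite projective dimension. -/

/-- Over a Noetherian ring, Baer's criterion passes to direct sums of copies of a module. -/
theorem Module.Baer.finsupp {R : Type*} [Ring R] [IsNoetherianRing R] {Q : Type*} [AddCommGroup Q]
    [Module R Q] (h : Module.Baer R Q) (J : Type*) : Module.Baer R (J →₀ Q) := by
  classical
  intro I g
  obtain ⟨s, hs⟩ : (LinearMap.range g).FG := by
    rw [LinearMap.range_eq_map]
    exact (Module.Finite.fg_top (R := R) (M := I)).map g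
  -- As I is finitely generated, the image of `g` lives on finitely many coordinates, so extending
  -- those suffices.
  let T : Finset J := s.biUnion Finsupp.support
  have hT : ∀ x, (g x).support ⊆ T := by
    have : LinearMap.range g ≤ Finsupp.supported Q R (T : Set J) := by
      rw [← hs, Submodule.span_le]
      intro y hy
      exact Finset.coe_subset.2 (Finset.subset_biUnion_of_mem Finsupp.support hy)
    intro x
    exact Finset.coe_subset.1 (this ⟨x, rfl⟩)
  choose G hG using fun j => h I ((Finsupp.lapply j).comp g)
  refine ⟨LinearMap.toSpanSingleton R _ (∑ j ∈ T, Finsupp.single j (G j 1)), fun x hx => ?_⟩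
  ext j
  simp only [LinearMap.toSpanSingleton_apply, Finsupp.smul_apply, Finsupp.finsetSum_apply,
    Finsupp.single_apply, Finset.sum_ite_eq']
  split_ifs with hj
  · rw [← map_smul, smul_eq_mul, mul_one]
    exact hG j x hx
  · rw [smul_zero]
    exact (Finsupp.notMem_support_iff.1 fun h' => hj (hT _ h')).symm

section

variable {R : Type v} [Ring R]

/-- If every direct sum of copies of `R` has injective dimension at most `n`, then a module of
finite projective dimension has projective dimension at most `n`. -/
theorem ModuleCat.projectiveDimension_le_of_hasInjectiveDimensionLE_finsupp {n : ℕ}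
    (h : ∀ J : Type (max v w), HasInjectiveDimensionLE (ModuleCat.of R (J →₀ R)) n)
    (M : ModuleCat.{max v w} R) :
    projectiveDimension M = ⊤ ∨ projectiveDimension M ≤ (n : WithBot ℕ∞) := by
  let := HasExt.standard (ModuleCat.{max v w} R)
  by_cases hM : projectiveDimension M = ⊤
  · exact .inl hM
  refine .inr ?_
  obtain ⟨m, hm⟩ := (projectiveDimension_ne_top_iff M).1 hM
  rw [projectiveDimension_le_iff]
  have : HasProjectiveDimensionLT M (n + 1 + m) := hasProjectiveDimensionLT_of_ge M (m + 1) _ (by lia)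
  clear hm
  induction m with
  | zero => exact this
  | succ m ih =>
    refine ih ((hasProjectiveDimensionLT_iff M _).2 fun i hi Y e => ?_)
    -- The obstruction to lifting `e` along the free cover of `Y` lies in Ext^(i+1)(M, ker p) = 0,
    -- and the lift vanishes because i > n.
    let p : ModuleCat.of R (Y →₀ R) ⟶ Y := ModuleCat.ofHom (Finsupp.linearCombination R id)
    have hp : Epi p := by
      rw [ModuleCat.epi_iff_surjective]
      exact Finsupp.linearCombination_surjective R Function.surjective_id
    have hS : (ShortComplex.mk _ _ (kernel.condition p)).ShortExact :=
      { exact := ShortComplex.exact_kernel p }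
    have := h Y
    obtain ⟨y, rfl⟩ := Abelian.Ext.covariant_sequence_exact₃ _ hS e rfl
      (Abelian.Ext.eq_zero_of_hasProjectiveDimensionLT _ (n + 1 + (m + 1)) (by lia))
    rw [Abelian.Ext.eq_zero_of_hasInjectiveDimensionLT y (n + 1) (by lia), Abelian.Ext.zero_comp]

/-- Dimension shifting along `0 → N → Q → N' → 0`, for direct sums of copies. -/
theorem ModuleCat.hasInjectiveDimensionLT_finsupp_of_exact [IsNoetherianRing R]
    {N Q N' : Type v} [AddCommGroup N] [AddCommGroup Q] [AddCommGroup N'] [Module R N] [Module R Q]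
    [Module R N'] (i : N →ₗ[R] Q) (p : Q →ₗ[R] N') (hi : Function.Injective i)
    (hp : Function.Surjective p) (hip : Function.Exact i p) (hQ : Module.Baer R Q) (m : ℕ)
    (J : Type (max v w)) (h : HasInjectiveDimensionLT (ModuleCat.of R (J →₀ N')) m) :
    HasInjectiveDimensionLT (ModuleCat.of R (J →₀ N)) (m + 1) := by
  have hJ : Injective (ModuleCat.of R (J →₀ Q)) :=
    (Module.injective_iff_injective_object R _).1 (hQ.finsupp J).injective
  have hip0 : p ∘ₗ i = 0 := hip.linearMap_comp_eq_zero
  let S : ShortComplex (ModuleCat.{max v w} R) := ShortComplex.mk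
    (ModuleCat.ofHom (Finsupp.mapRange.linearMap (α := J) i))
    (ModuleCat.ofHom (Finsupp.mapRange.linearMap (α := J) p)) (by
      rw [← ModuleCat.ofHom_comp, ← Finsupp.mapRange.linearMap_comp, hip0]
      ext; simp)
  have hS : S.ShortExact :=
    { exact := by
        rw [ShortComplex.moduleCat_exact_iff]
        intro x hx
        have hx : ∀ j, p ((x : J →₀ Q) j) = 0 := fun j => DFunLike.congr_fun hx j
        choose y hy using fun j => (hip _).1 (hx j)
        classical
        -- Injectivity of `i` keeps the chosen preimages within the support of `x`.
        refine ⟨(Finsupp.onFinset (x : J →₀ Q).support y fun j hj => ?_ : J →₀ N), ?_⟩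
        · rw [Finsupp.mem_support_iff]
          rintro hj'
          exact hj (hi (by rw [hy, hj', map_zero]))
        · exact Finsupp.ext hy
      mono_f := by
        rw [ModuleCat.mono_iff_injective]
        exact Finsupp.mapRange_injective _ (map_zero _) hi
      epi_g := by
        rw [ModuleCat.epi_iff_surjective]
        exact Finsupp.mapRange_surjective _ (map_zero _) hp }
  exact hS.hasInjectiveDimensionLT_X₁ m h
    (hasInjectiveDimensionLT_of_ge (ModuleCat.of R (J →₀ Q)) 1 _ (by lia))

theorem ModuleCat.hasInjectiveDimensionLT_finsupp_of_linearEquiv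
    {N N' : Type v} [AddCommGroup N] [AddCommGroup N'] [Module R N] [Module R N'] (e : N ≃ₗ[R] N')
    (m : ℕ) (J : Type (max v w)) (h : HasInjectiveDimensionLT (ModuleCat.of R (J →₀ N)) m) :
    HasInjectiveDimensionLT (ModuleCat.of R (J →₀ N')) m :=
  hasInjectiveDimensionLT_of_iso
    (show ModuleCat.of R (J →₀ N) ≅ ModuleCat.of R (J →₀ N') from
      (Finsupp.mapRange.linearEquiv (α := J) e).toModuleIso) m

end

/-! ### Exactness of angles. -/

namespace HigherAngulated

variable {C : Type u} [Category.{v} C]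

theorem SuspSeq.extMap_castSucc {S : C ⥤ C} {n : ℕ} (A : SuspSeq S n) (i : Fin (n + 1)) :
    A.extMap i.castSucc =
      eqToHom (A.ext_castSucc _) ≫ A.map i ≫ eqToHom (A.ext_castSucc i.succ).symm := by
  rw [SuspSeq.extMap, Fin.lastCases_castSucc]

theorem SuspSeq.extMap_last {S : C ⥤ C} {n : ℕ} (A : SuspSeq S n) :
    A.extMap (Fin.last (n + 1)) =
      eqToHom (A.ext_castSucc _) ≫ A.last ≫ eqToHom A.ext_last.symm := by
  rw [SuspSeq.extMap, Fin.lastCases_last]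

variable [Preadditive C]

/-- `f` is a weak kernel of `g`, and `g` is a weak cokernel of `f`. -/
structure WeakExact {P Q R : C} (f : P ⟶ Q) (g : Q ⟶ R) : Prop where
  zero : f ≫ g = 0
  lift : ∀ ⦃W : C⦄ (w : W ⟶ Q), w ≫ g = 0 → ∃ w', w = w' ≫ f
  desc : ∀ ⦃Z : C⦄ (z : Q ⟶ Z), f ≫ z = 0 → ∃ z', z = g ≫ z'

theorem SuspSeq.rotate_last {S : C ⥤ C} {n : ℕ} (A : SuspSeq S n) :
    A.rotate.last = eqToHom A.ext_last ≫ ((-1 : ℤ) ^ n • S.map A.first) ≫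
      S.map (eqToHom (A.ext_castSucc (Fin.succ 0)).symm) := by
  rw [eqToHom_map]
  rfl

theorem comp_cancel_zero {V W B B' D E : C} (t : V ⟶ W) {w : W ⟶ B} (a : B ⟶ B') (a' : B' ⟶ B)
    {f : B ⟶ D} (d : D ⟶ E) (ha : a ≫ a' = 𝟙 B) (hw : w ≫ f = 0) :
    (t ≫ w ≫ a) ≫ a' ≫ f ≫ d = 0 := by
  simp only [Category.assoc, reassoc_of% ha, reassoc_of% hw, zero_comp, comp_zero]

/-- Strips the suspension, the sign and the identifications of objects from the last square of a
morphism between rotated sequences. -/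
theorem exists_eq_comp_of_map (S : C ⥤ C) [S.Additive] [S.Full] [S.Faithful] {n : ℕ}
    {W V B₀ B₁ B P Q : C} (p : P ⟶ S.obj W) [IsIso p] {q : Q ⟶ S.obj B₀} {b : B₀ ⟶ B₁}
    {t : W ⟶ V} {t' : V ⟶ W} (a : B₁ ⟶ B) [IsIso a] (ht : t ≫ t' = 𝟙 W) {w : W ⟶ B₁} {x : P ⟶ Q}
    (h : (p ≫ ((-1 : ℤ) ^ n • S.map (𝟙 W)) ≫ S.map t) ≫ S.map (t' ≫ w ≫ a) =
      x ≫ q ≫ ((-1 : ℤ) ^ n • S.map b) ≫ S.map a) : ∃ w', w = w' ≫ b := by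
  have h' : p ≫ S.map w ≫ S.map a = x ≫ q ≫ S.map b ≫ S.map a := by
    have ht' : S.map t ≫ S.map t' = 𝟙 _ := by rw [← S.map_comp, ht, S.map_id]
    obtain hn | hn := neg_one_pow_eq_or ℤ n <;> rw [hn] at h <;>
      simpa [reassoc_of% ht'] using h
  obtain ⟨w', hw'⟩ := S.map_surjective (inv p ≫ x ≫ q)
  refine ⟨w', S.map_injective ?_⟩
  rw [S.map_comp, hw', ← cancel_epi p, ← cancel_mono (S.map a)]
  simpa using h'

theorem WeakExact.of_eqToHom {P Q R P' Q' R' : C} {f : P ⟶ Q} {g : Q ⟶ R} (h : WeakExact f g)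
    {f' : P' ⟶ Q'} {g' : Q' ⟶ R'} (hP : P = P') (hQ : Q = Q') (hR : R = R')
    (hf : f = eqToHom hP ≫ f' ≫ eqToHom hQ.symm) (hg : g = eqToHom hQ ≫ g' ≫ eqToHom hR.symm) :
    WeakExact f' g' := by
  subst hP hQ hR
  simpa [hf, hg] using h

theorem WeakExact.to_eqToHom {P Q R P' Q' R' : C} {f' : P' ⟶ Q'} {g' : Q' ⟶ R'}
    (h : WeakExact f' g') {f : P ⟶ Q} {g : Q ⟶ R} (hP : P = P') (hQ : Q = Q') (hR : R = R')
    (hf : f = eqToHom hP ≫ f' ≫ eqToHom hQ.symm) (hg : g = eqToHom hQ ≫ g' ≫ eqToHom hR.symm) :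
    WeakExact f g := by
  subst hP hQ hR
  simpa [hf, hg] using h

theorem WeakExact.of_zsmul_right {P Q R : C} {f : P ⟶ Q} {g : Q ⟶ R} {n : ℕ}
    (h : WeakExact f ((-1 : ℤ) ^ n • g)) : WeakExact f g := by
  obtain hn | hn := neg_one_pow_eq_or ℤ n <;> rw [hn] at h
  · simpa using h
  · rw [neg_one_smul] at h
    exact
      { zero := by simpa using h.zero
        lift := fun W w hw => h.lift w (by simpa using hw)
        desc := fun Z z hz => by
          obtain ⟨z', hz'⟩ := h.desc z hz
          exact ⟨-z', by simpa using hz'⟩ }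

variable [HasZeroObject C] [HasFiniteBiproducts C]

attribute [local instance] hasBinaryBiproducts_of_finite_biproducts

namespace SuspSeq

open scoped ZeroObject

omit [HasFiniteBiproducts C] in
theorem trivial_isZero (S : C ⥤ C) (n : ℕ) (Z : C) (i : Fin n) :
    IsZero ((trivial S n Z).obj i.succ.succ) := by
  exact isZero_zero C

/-- The sequence `0 ⟶ Z ⟶ Z ⟶ 0 ⟶ ⋯ ⟶ 0 ⟶ S 0`. -/
noncomputable def shiftedTrivial (S : C ⥤ C) (m : ℕ) (Z : C) : SuspSeq S (m + 1) where
  obj := Fin.cons (α := fun _ => C) 0 (Fin.cons (α := fun _ => C) Z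
    (Fin.cons (α := fun _ => C) Z (fun _ => (0 : C))))
  map := Fin.cases 0 (Fin.cases (𝟙 Z) (fun _ => 0))
  last := 0

end SuspSeq

namespace IsAngulated

variable {S : C ⥤ C} {m : ℕ} {Θ : Set (SuspSeq S (m + 1))} (hΘ : IsAngulated S (m + 1) Θ)
include hΘ

open scoped ZeroObject

theorem additive : S.Additive := by
  have := hΘ.isEquivalence
  have : S.PreservesZeroMorphisms := inferInstance
  have := preservesBinaryBiproducts_of_preservesBinaryProducts S
  exact Functor.additive_of_preservesBinaryBiproducts S

/-- Its left rotation is isomorphic to the trivial sequence on `Z`, because S 0 = 0. The final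
square commutes for free: as n ≥ 1, the last term of the trivial sequence is zero. -/
theorem shiftedTrivial_mem (Z : C) : SuspSeq.shiftedTrivial S m Z ∈ Θ := by
  have := hΘ.additive
  rw [← hΘ.rotate_mem_iff]
  have h0 : IsZero (S.obj (0 : C)) := S.map_isZero (isZero_zero C)
  have hz : ∀ i : Fin (m + 1),
      IsZero ((SuspSeq.shiftedTrivial S m Z).rotate.obj i.succ.succ) := by
    intro i
    refine Fin.lastCases ?_ (fun j => ?_) i
    · refine IsZero.of_iso h0 (eqToIso ?_)
      exact SuspSeq.ext_last _
    · refine IsZero.of_iso (isZero_zero C) (eqToIso ?_)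
      exact SuspSeq.ext_castSucc _ j.succ.succ.succ
  let e₀ := eqToIso ((SuspSeq.shiftedTrivial S m Z).ext_castSucc (Fin.succ 0))
  let e₁ := eqToIso ((SuspSeq.shiftedTrivial S m Z).ext_castSucc (Fin.succ (Fin.succ 0)))
  let φ : SuspSeq.Hom (SuspSeq.trivial S (m + 1) Z) (SuspSeq.shiftedTrivial S m Z).rotate :=
    { app := Fin.cases e₀.inv (Fin.cases e₁.inv fun i => 0)
      comm := by
        refine Fin.cases ?_ fun i => ?_
        · have := (SuspSeq.shiftedTrivial S m Z).extMap_castSucc (Fin.succ 0)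
          change 𝟙 Z ≫ e₁.inv = e₀.inv ≫ SuspSeq.extMap _ (Fin.castSucc (Fin.succ 0))
          rw [this]
          exact (Category.id_comp e₁.inv).trans ((e₀.inv_hom_id_assoc _).trans
            (Category.id_comp e₁.inv)).symm
        · exact (hz i).eq_of_tgt _ _
      comm_last := (SuspSeq.trivial_isZero S (m + 1) Z (Fin.last m)).eq_of_src _ _ }
  refine hΘ.iso_mem _ _ φ ?_ (hΘ.trivial_mem Z)
  refine Fin.cases ?_ (Fin.cases ?_ fun i => ?_)
  · exact inferInstanceAs (IsIso e₀.inv)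
  · exact inferInstanceAs (IsIso e₁.inv)
  · exact ⟨0, (SuspSeq.trivial_isZero S (m + 1) Z i).eq_of_src _ _, (hz i).eq_of_src _ _⟩

/-- Each part completes a square to a morphism of angles: from the trivial angle on A_0 for `zero`,
between the rotations of the trivial angle on `W` and of `A` for `lift` (the last square yields the
factorization), and into the shifted trivial angle on `Z` for `desc`. -/
theorem weakExact_map {A : SuspSeq S (m + 1)} (hA : A ∈ Θ) :
    WeakExact (A.map 0) (A.map (Fin.succ 0)) where
  zero := by
    obtain ⟨φ, -, h1⟩ := hΘ.complete _ (hΘ.trivial_mem (A.obj 0)) A hA (𝟙 _) A.first (by rfl)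
    have := φ.comm (Fin.succ 0)
    rw [(SuspSeq.trivial_isZero S (m + 1) (A.obj 0) 0).eq_of_tgt
      ((SuspSeq.trivial S (m + 1) (A.obj 0)).map (Fin.succ 0)) 0, zero_comp] at this
    refine Eq.trans ?_ this.symm
    exact congrArg (fun f => f ≫ A.map (Fin.succ 0)) h1.symm
  lift W w hw := by
    have := hΘ.additive
    have := hΘ.isEquivalence
    let T := SuspSeq.trivial S (m + 1) W
    have hT : T ∈ Θ := hΘ.trivial_mem W
    let t := eqToHom (T.ext_castSucc (Fin.succ 0))
    let a := eqToHom (A.ext_castSucc (Fin.succ 0)).symm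
    have hfirst : A.rotate.first = eqToHom (A.ext_castSucc (Fin.succ 0)) ≫ A.map (Fin.succ 0) ≫
        eqToHom (A.ext_castSucc (Fin.succ 0).succ).symm := A.extMap_castSucc (Fin.succ 0)
    have hTfirst : T.rotate.first = 0 := by
      refine IsZero.eq_of_tgt (IsZero.of_iso (isZero_zero C) (eqToIso ?_)) _ _
      exact T.ext_castSucc (Fin.succ (Fin.succ 0))
    obtain ⟨φ, h0, -⟩ := hΘ.complete _ ((hΘ.rotate_mem_iff T).2 hT) _ ((hΘ.rotate_mem_iff A).2 hA)
      (t ≫ w ≫ a) 0 (by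
        rw [hTfirst, zero_comp, hfirst]
        exact (comp_cancel_zero t a _ _ (eqToHom_trans _ _) hw).symm)
    have h := φ.comm_last
    rw [h0, T.rotate_last, A.rotate_last] at h
    exact exists_eq_comp_of_map S (eqToHom T.ext_last)
      (eqToHom (A.ext_castSucc (Fin.succ 0)).symm) (eqToHom_trans _ _) h
  desc Z z hz := by
    obtain ⟨φ, -, h1⟩ := hΘ.complete A hA _ (hΘ.shiftedTrivial_mem Z) 0 z
      (by rw [zero_comp]; exact hz)
    have := φ.comm (Fin.succ 0)
    refine ⟨φ.app (Fin.succ (Fin.succ 0)), Eq.trans ?_ this.symm⟩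
    exact h1.symm.trans (Category.comp_id (φ.app (Fin.succ 0))).symm

/-- Rotation moves position i + 1 to position i, so everything reduces to the first two maps. -/
theorem weakExact_extMap (i : Fin (m + 2)) {A : SuspSeq S (m + 1)} (hA : A ∈ Θ) :
    WeakExact (A.extMap i.castSucc) (A.extMap i.succ) := by
  induction i using Fin.induction generalizing A with
  | zero =>
    exact (hΘ.weakExact_map hA).to_eqToHom (A.ext_castSucc 0)
      (A.ext_castSucc (Fin.succ 0)) (A.ext_castSucc (Fin.succ (Fin.succ 0)))
      (A.extMap_castSucc 0) (A.extMap_castSucc (Fin.succ 0))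
  | succ i ih =>
    exact (ih ((hΘ.rotate_mem_iff A).2 hA)).of_eqToHom (A.rotate.ext_castSucc _)
      (A.rotate.ext_castSucc i.castSucc.succ) (A.rotate.ext_castSucc i.succ.succ)
      (A.rotate.extMap_castSucc i.castSucc) (A.rotate.extMap_castSucc i.succ)

theorem weakExact_map_map {A : SuspSeq S (m + 1)} (hA : A ∈ Θ) (i : Fin (m + 1)) :
    WeakExact (A.map i.castSucc) (A.map i.succ) :=
  (hΘ.weakExact_extMap i.castSucc hA).of_eqToHom (A.ext_castSucc _) (A.ext_castSucc i.castSucc.succ)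
    (A.ext_castSucc i.succ.succ) (A.extMap_castSucc i.castSucc) (A.extMap_castSucc i.succ)

theorem weakExact_map_last {A : SuspSeq S (m + 1)} (hA : A ∈ Θ) :
    WeakExact (A.map (Fin.last (m + 1))) A.last :=
  (hΘ.weakExact_extMap (Fin.last (m + 1)) hA).of_eqToHom (A.ext_castSucc _)
    (A.ext_castSucc (Fin.last (m + 2))) A.ext_last (A.extMap_castSucc (Fin.last (m + 1))) A.extMap_last

theorem weakExact_last_map_first {A : SuspSeq S (m + 1)} (hA : A ∈ Θ) :
    WeakExact A.last (S.map A.first) := by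
  have h : WeakExact A.last ((-1 : ℤ) ^ (m + 1) • S.map A.first) :=
    (hΘ.weakExact_map_last ((hΘ.rotate_mem_iff A).2 hA)).of_eqToHom
      (A.ext_castSucc (Fin.last (m + 2))) A.ext_last
      (congrArg S.obj (A.ext_castSucc (Fin.succ 0))) A.extMap_last rfl
  exact h.of_zsmul_right

end IsAngulated

end HigherAngulated

/-! ### Injectivity of Hom(X, S²Y) for Y in add X. -/

namespace HigherAngulated

variable {C : Type u} [Category.{v} C] [Preadditive C] [HasZeroObject C] [HasFiniteBiproducts C]

attribute [local instance] hasBinaryBiproducts_of_finite_biproducts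

omit [HasZeroObject C] in
theorem InAdd.eq_zero_of_comp {X Y Z : C} (hY : InAdd X Y) {f : Y ⟶ Z}
    (h : ∀ x : X ⟶ Y, x ≫ f = 0) : f = 0 := by
  obtain ⟨m, W, ⟨e⟩⟩ := hY
  have h0 : e.inv ≫ biprod.fst ≫ f = 0 := by
    refine biproduct.hom_ext' _ _ fun j => ?_
    simpa using h (biproduct.ι (fun _ : Fin m => X) j ≫ e.inv ≫ biprod.fst)
  calc f = biprod.inl ≫ e.hom ≫ e.inv ≫ biprod.fst ≫ f := by simp
    _ = 0 := by rw [h0, comp_zero, comp_zero]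

omit [HasZeroObject C] in
theorem InAdd.hom_map_eq_zero {S : C ⥤ C} [S.Additive] {X Y W : C} (hY : InAdd X Y)
    (h : ∀ f : W ⟶ S.obj X, f = 0) (f : W ⟶ S.obj Y) : f = 0 := by
  obtain ⟨m, Z, ⟨e⟩⟩ := hY
  have h0 : f ≫ S.map (biprod.inl ≫ e.hom) = 0 := by
    rw [← Category.comp_id (biprod.inl ≫ e.hom), ← biproduct.total, Preadditive.comp_sum,
      S.map_sum, Preadditive.comp_sum]
    refine Finset.sum_eq_zero fun j _ => ?_
    rw [← Category.assoc, S.map_comp, ← Category.assoc, h (f ≫ _), zero_comp]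
  calc f = f ≫ S.map (biprod.inl ≫ e.hom) ≫ S.map (e.inv ≫ biprod.fst) := by
        rw [← S.map_comp]; simp
    _ = 0 := by rw [← Category.assoc, h0, zero_comp]

variable {S : C ⥤ C} {m : ℕ} {Θ : Set (SuspSeq S (m + 1))} {X : C}

omit [HasZeroObject C] in
theorem IsClusterTilting.hom_map_eq_zero [S.Additive] (hX : IsClusterTilting Θ X) {B Y : C}
    (hB : InAdd X B) (hY : InAdd X Y) (f : B ⟶ S.obj Y) : f = 0 :=
  hB.eq_zero_of_comp fun _ => hY.hom_map_eq_zero hX.rigid _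

/-- A map `v : P ⟶ S (S Y)` with `Y` in `add X` factors through `u : P ⟶ Q` as soon as it
kills all maps `X ⟶ P` killed by `u`. -/
theorem IsClusterTilting.exists_factor (hΘ : IsAngulated S (m + 1) Θ)
    (hX : IsClusterTilting Θ X) {P Q Y : C} (hY : InAdd X Y) (u : P ⟶ Q) (v : P ⟶ S.obj (S.obj Y))
    (h : ∀ x : X ⟶ P, x ≫ u = 0 → x ≫ v = 0) : ∃ q, v = u ≫ q := by
  have := hΘ.additive
  have := hΘ.isEquivalence
  obtain ⟨A, hA, e₀, e₁, he⟩ := hΘ.extend u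
  obtain ⟨B, hB, hBX, ⟨b⟩⟩ := hX.exists_angle (S.objPreimage (A.obj (Fin.last (m + 2))))
  let e := S.mapIso b ≪≫ S.objObjPreimageIso (A.obj (Fin.last (m + 2)))
  -- `d` desuspends the last map of the angle on `u`; the goal becomes that `v` kills `d`.
  obtain ⟨d, hd⟩ := S.map_surjective (e.hom ≫ A.last)
  have hdu : d ≫ A.first = 0 := S.map_injective (by
    rw [S.map_comp, hd, Category.assoc, (hΘ.weakExact_last_map_first hA).zero, comp_zero,
      S.map_zero])
  have hBv : B.map (Fin.last (m + 1)) ≫ d ≫ e₀.inv ≫ v = 0 := by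
    refine (hBX (Fin.last (m + 1))).eq_zero_of_comp fun x => ?_
    have := h (x ≫ B.map (Fin.last (m + 1)) ≫ d ≫ e₀.inv) (by
      rw [← cancel_mono e₁.hom]
      simp only [Category.assoc, he, e₀.inv_hom_id_assoc, zero_comp]
      rw [hdu, comp_zero, comp_zero])
    simpa using this
  -- Killing B_n, the composite of `d` and `v` factors through S B_0 → S(S Y), which is zero by
  -- rigidity.
  obtain ⟨z, hz⟩ := (hΘ.weakExact_map_last hB).desc _ hBv
  obtain ⟨z, rfl⟩ := S.map_surjective z
  have hz0 : z = 0 := hX.hom_map_eq_zero (hBX 0) hY z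
  rw [hz0, S.map_zero, comp_zero] at hz
  obtain ⟨q, hq⟩ := (hΘ.weakExact_last_map_first hA).desc (S.map (e₀.inv ≫ v)) (by
    rw [← cancel_epi e.hom, ← Category.assoc, ← hd, ← S.map_comp, hz, S.map_zero, comp_zero])
  obtain ⟨q, rfl⟩ := S.map_surjective q
  rw [← S.map_comp] at hq
  have hq := S.map_injective hq
  exact ⟨e₁.hom ≫ q, by rw [reassoc_of% he, ← hq, e₀.hom_inv_id_assoc]⟩

/-- Generators r_i of the ideal form u : X^a → X, and their images form v : X^a → S²Y. A map x : X →
X^a with x ≫ u = 0 is a relation among the r_i, hence is killed by v. So v = u ≫ q, and q extends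
`g`. -/
theorem IsClusterTilting.baer (hΘ : IsAngulated S (m + 1) Θ)
    (hX : IsClusterTilting Θ X) [IsNoetherianRing (End X)ᵐᵒᵖ] {Y : C} (hY : InAdd X Y) :
    Module.Baer (End X)ᵐᵒᵖ (X ⟶ S.obj (S.obj Y)) := by
  intro I g
  obtain ⟨a, r, hr⟩ := Submodule.fg_iff_exists_fin_generating_family.1
    ((isNoetherianRing_iff_ideal_fg _).1 inferInstance I)
  have hrI : ∀ i, r i ∈ I := fun i => hr ▸ Submodule.subset_span ⟨i, rfl⟩
  let u : (⨁ fun _ : Fin a => X) ⟶ X := biproduct.desc fun i => (r i).unop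
  let v : (⨁ fun _ : Fin a => X) ⟶ S.obj (S.obj Y) := biproduct.desc fun i => g ⟨r i, hrI i⟩
  have hx : ∀ (c : Fin a → (End X)ᵐᵒᵖ) (hc : ∑ i, c i * r i ∈ I),
      g ⟨∑ i, c i * r i, hc⟩ = biproduct.lift (fun i => (c i).unop) ≫ v := by
    intro c hc
    have : (⟨∑ i, c i * r i, hc⟩ : I) = ∑ i, c i • (⟨r i, hrI i⟩ : I) := by
      ext; simp
    rw [this, map_sum, biproduct.lift_desc]
    exact Finset.sum_congr rfl fun i _ => map_smul g _ _
  have hu : ∀ c : Fin a → (End X)ᵐᵒᵖ,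
      (∑ i, c i * r i).unop = biproduct.lift (fun i => (c i).unop) ≫ u := by
    intro c
    rw [biproduct.lift_desc, Finset.unop_sum]
    rfl
  obtain ⟨q, hq⟩ := hX.exists_factor hΘ hY u v fun x hxu => by
    let c : Fin a → (End X)ᵐᵒᵖ := fun i => MulOpposite.op (x ≫ biproduct.π _ i)
    have hxc : x = biproduct.lift (fun i => (c i).unop) :=
      biproduct.hom_ext _ _ fun i => (biproduct.lift_π (fun i => (c i).unop) i).symm
    have h0 : ∑ i, c i * r i = 0 := MulOpposite.unop_injective (by
      rw [hu c, ← hxc, hxu]; rfl)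
    rw [hxc, ← hx c (by rw [h0]; exact I.zero_mem)]
    exact (congrArg g (Subtype.ext h0)).trans (map_zero g)
  refine ⟨LinearMap.toSpanSingleton _ _ q, fun x hxI => ?_⟩
  obtain ⟨c, rfl⟩ := (Submodule.mem_span_range_iff_exists_fun _).1 (hr.symm ▸ hxI)
  refine Eq.trans ?_ (hx c hxI).symm
  rw [hq, ← Category.assoc, ← hu c]
  rfl

end HigherAngulated

/-! ### The injective coresolution of Γ. -/

namespace HigherAngulated

variable {C : Type u} [Category.{v} C] [Preadditive C]

theorem WeakExact.map {P Q R : C} {f : P ⟶ Q} {g : Q ⟶ R} (h : WeakExact f g) (S : C ⥤ C)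
    [S.Additive] [S.IsEquivalence] : WeakExact (S.map f) (S.map g) where
  zero := by rw [← S.map_comp, h.zero, S.map_zero]
  lift W w hw := by
    obtain ⟨x, hx⟩ := S.map_surjective ((S.objObjPreimageIso W).hom ≫ w)
    obtain ⟨y, rfl⟩ := h.lift x (S.map_injective (by
      rw [S.map_comp, hx, Category.assoc, hw, comp_zero, S.map_zero]))
    exact ⟨(S.objObjPreimageIso W).inv ≫ S.map y, by
      rw [Category.assoc, ← S.map_comp, hx, Iso.inv_hom_id_assoc]⟩
  desc Z z hz := by
    obtain ⟨x, hx⟩ := S.map_surjective (z ≫ (S.objObjPreimageIso Z).inv)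
    obtain ⟨y, rfl⟩ := h.desc x (S.map_injective (by
      rw [S.map_comp, hx, reassoc_of% hz, zero_comp, S.map_zero]))
    exact ⟨S.map y ≫ (S.objObjPreimageIso Z).hom, by
      rw [← Category.assoc, ← S.map_comp, hx, Category.assoc, Iso.inv_hom_id, Category.comp_id]⟩

/-- Postcomposition with `f`, as a map of right modules over `End X`. -/
def postcomp (X : C) {Y Z : C} (f : Y ⟶ Z) : (X ⟶ Y) →ₗ[(End X)ᵐᵒᵖ] (X ⟶ Z) where
  toFun x := x ≫ f
  map_add' _ _ := Preadditive.add_comp _ _ _ _ _ _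
  map_smul' _ _ := Category.assoc _ _ _

variable [HasZeroObject C] [HasFiniteBiproducts C]

attribute [local instance] hasBinaryBiproducts_of_finite_biproducts

variable {S : C ⥤ C} {m : ℕ} {Θ : Set (SuspSeq S (m + 1))} {X : C}

/-- Descending induction: by exactness, the kernel at i embeds in the injective Hom(X, S²A_i) with
the kernel at i + 1 as cokernel. The strict bound m + 2 - i means dimension at most n - i. -/
theorem IsClusterTilting.hasInjectiveDimensionLT_ker (hΘ : IsAngulated S (m + 1) Θ)
    (hX : IsClusterTilting Θ X) [IsNoetherianRing (End X)ᵐᵒᵖ] {A : SuspSeq S (m + 1)} (hA : A ∈ Θ)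
    (hAX : ∀ i : Fin (m + 2), InAdd X (A.obj i.castSucc))
    (h0 : ∀ f : X ⟶ S.obj (S.obj (A.obj (Fin.last (m + 2)))), f = 0) (i : Fin (m + 2))
    (J : Type (max v w)) :
    HasInjectiveDimensionLT (ModuleCat.of (End X)ᵐᵒᵖ
      (J →₀ LinearMap.ker (postcomp X (S.map (S.map (A.map i)))))) (m + 2 - i) := by
  have := hΘ.additive
  have := hΘ.isEquivalence
  induction i using Fin.reverseInduction with
  | last =>
    have h1 : m + 2 - (Fin.last (m + 1)).val = 0 + 1 := by simp
    rw [h1]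
    -- By `h0` the last kernel is all of Hom(X, S²A_n), so the cokernel is zero.
    refine ModuleCat.hasInjectiveDimensionLT_finsupp_of_exact.{w} (N' := PUnit.{v + 1})
      (LinearMap.ker (postcomp X (S.map (S.map (A.map (Fin.last (m + 1))))))).subtype 0
      (Submodule.subtype_injective _) (fun _ => ⟨0, rfl⟩) (fun x => ?_)
      (hX.baer hΘ (hAX _)) 0 J
      (ModuleCat.isZero_of_subsingleton _).hasInjectiveDimensionLT_zero
    exact ⟨fun _ => ⟨⟨x, h0 _⟩, rfl⟩, fun _ => rfl⟩
  | cast i ih =>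
    have h1 : m + 2 - i.castSucc.val = (m + 2 - i.succ.val) + 1 := by
      simp only [Fin.val_castSucc, Fin.val_succ]; lia
    rw [h1]
    have hex := ((hΘ.weakExact_map_map hA i).map S).map S
    refine ModuleCat.hasInjectiveDimensionLT_finsupp_of_exact.{w}
      (LinearMap.ker (postcomp X (S.map (S.map (A.map i.castSucc))))).subtype
      ((postcomp X (S.map (S.map (A.map i.castSucc)))).codRestrict
        (LinearMap.ker (postcomp X (S.map (S.map (A.map i.succ))))) fun x => ?_)
      (Submodule.subtype_injective _) (fun x => ?_) (fun x => ?_)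
      (hX.baer hΘ (hAX _)) _ J ih
    · exact (Category.assoc _ _ _).trans ((congrArg (x ≫ ·) hex.zero).trans comp_zero)
    · obtain ⟨y, hy⟩ := hex.lift x.1 x.2
      exact ⟨y, Subtype.ext hy.symm⟩
    · exact ⟨fun hx => ⟨⟨x, congrArg Subtype.val hx⟩, rfl⟩,
        fun ⟨y, hy⟩ => Subtype.ext (hy ▸ y.2)⟩

/-- The endomorphism ring of a cluster tilting object has injective dimension at most `n` as a
right module, and so has each direct sum of copies of it. -/
theorem IsClusterTilting.hasInjectiveDimensionLE_finsupp (hΘ : IsAngulated S (m + 1) Θ)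
    (hX : IsClusterTilting Θ X) [IsNoetherianRing (End X)ᵐᵒᵖ] (J : Type (max v w)) :
    HasInjectiveDimensionLE (ModuleCat.of (End X)ᵐᵒᵖ (J →₀ (End X)ᵐᵒᵖ)) (m + 1) := by
  have := hΘ.additive
  have := hΘ.isEquivalence
  obtain ⟨A, hA, hAX, ⟨b⟩⟩ := hX.exists_angle (S.objPreimage X)
  let e : X ≅ S.obj (A.obj (Fin.last (m + 2))) := (S.objObjPreimageIso X).symm ≪≫ S.mapIso b.symm
  have h0 : ∀ f : X ⟶ S.obj (S.obj (A.obj (Fin.last (m + 2)))), f = 0 := fun f => by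
    rw [← cancel_mono (S.map e.inv), zero_comp]
    exact hX.rigid _
  have hA₀ : WeakExact (S.map A.last) (S.map (S.map (A.map 0))) :=
    (hΘ.weakExact_last_map_first hA).map S
  have hA₁ := (hΘ.weakExact_map_last hA).map S
  -- The augmentation Γ → Hom(X, S²A_0), injective because Hom(X, S A_n) = 0.
  let ψ : (X ⟶ X) →ₗ[(End X)ᵐᵒᵖ] LinearMap.ker (postcomp X (S.map (S.map (A.map 0)))) :=
    (postcomp X (e.hom ≫ S.map A.last)).codRestrict _ fun x => by
      change (x ≫ e.hom ≫ S.map A.last) ≫ S.map (S.map (A.map 0)) = 0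
      rw [Category.assoc, Category.assoc, hA₀.zero, comp_zero, comp_zero]
  have hψ : Function.Bijective ψ := by
    constructor
    · rw [injective_iff_map_eq_zero]
      intro x hx
      have hx : (x ≫ e.hom) ≫ S.map A.last = 0 :=
        (Category.assoc _ _ _).trans (congrArg Subtype.val hx)
      obtain ⟨y, hy⟩ := hA₁.lift _ hx
      have hy0 : y = 0 := (hAX (Fin.last (m + 1))).hom_map_eq_zero hX.rigid y
      rw [hy0, zero_comp] at hy
      rw [← cancel_mono e.hom, hy, zero_comp]
    · intro x
      obtain ⟨y, hy⟩ := hA₀.lift x.1 x.2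
      refine ⟨y ≫ e.inv, Subtype.ext (Eq.trans ?_ hy.symm)⟩
      change (y ≫ e.inv) ≫ e.hom ≫ S.map A.last = _
      rw [Category.assoc, e.inv_hom_id_assoc]
  let E := (LinearEquiv.ofBijective ψ hψ).symm.trans (Preadditive.homSelfLinearEquivEndMulOpposite X)
  exact ModuleCat.hasInjectiveDimensionLT_finsupp_of_linearEquiv.{w} E _ J
    (hX.hasInjectiveDimensionLT_ker hΘ hA hAX h0 0 J)

end HigherAngulated

/-- Right modules over `Γ = End X` are modules over `(End X)ᵐᵒᵖ`; the product in `End X` is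
composition of maps. -/
theorem corollary2p5 {k : Type*} [Field k] {C : Type u} [Category.{v} C] [Preadditive C]
    [Linear k C] [HasZeroObject C] [HasFiniteBiproducts C] {n : ℕ} (hn : 1 ≤ n) (S : C ⥤ C)
    (Θ : Set (HigherAngulated.SuspSeq S n)) (hΘ : HigherAngulated.IsAngulated S n Θ)
    (X : C) (hX : HigherAngulated.IsClusterTilting Θ X) [Module.Finite k (End X)]
    (M : ModuleCat.{max v w} (End X)ᵐᵒᵖ) :
    projectiveDimension M = ⊤ ∨ projectiveDimension M ≤ (n : WithBot ℕ∞) := by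
  obtain ⟨m, rfl⟩ := Nat.exists_eq_add_of_le' hn
  have : Module.Finite k (End X)ᵐᵒᵖ := Module.Finite.equiv (MulOpposite.opLinearEquiv k)
  have : IsNoetherianRing (End X)ᵐᵒᵖ := IsNoetherianRing.of_finite k (End X)ᵐᵒᵖ
  exact ModuleCat.projectiveDimension_le_of_hasInjectiveDimensionLE_finsupp.{w}
    (fun J => hX.hasInjectiveDimensionLE_finsupp.{w} hΘ J) M
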